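/- **Setting.** There are finite sets of students $S$, districts $D$, schools $C$ and types $T$. Each student $s$ has a home district and a type $\tau(s)$; each school $c$ lies in a district and has a capacity $q_c$. A *matching* gives each student at most one school; it is *feasible* if no school $c$ receives more than $q_c$ students. A feasible initial matching gives each student $s$ exactly one school $c_0(s)$. Each student $s$ has a strict preference order $P_s$ over schools and being unmatched, with being unmatched ranked last; $R_s$ is the weak order of $P_s$. A *distribution* is a vector $\xi=(\xi_c^t)_{c\in C,t\in T}$ of nonnegative integers; the distribution $\xi(X)$ of a matching $X$ counts the type-$t$ students at school $c$. A *policy goal* is a set $\Xi$ of distributions, and $X$ satisfies it if $\xi(X)\in\Xi$. Let $\Xi^0$ be the set of distributions $\xi$ with $\sum_{c,t}\xi_c^t=|S|$ and $\sum_t\xi_c^t\le q_c$ for all $c$. Let $\chi_{c,t}$ be the distribution with a single student, of type $t$ and at school $c$. A set $F$ of distributions is *M-convex* if whenever $\xi,\tilde\xi\in F$ and $\xi_c^t>\tilde\xi_c^t$, there are $c',t'$ with $\xi_{c'}^{t'}<\tilde\xi_{c'}^{t'}$, $\xi-\chi_{c,t}+\chi_{c',t'}\in F$ and $\tilde\xi+\chi_{c,t}-\chi_{c',t'}\in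 F$. **Mechanism (TTC).** In the hypothetical market, students are matched to school-type pairs. The initial pair of $s$ is $(c_0(s),\tau(s))$. From $P_s$ form a strict order $\tilde P_s$ over pairs that ranks the pairs $(c,\tau(s))$ as $P_s$ ranks the schools $c$ and ranks $(c_0(s),\tau(s))$ above every pair of another type (any such choice, for every $s$ and $P_s$, is allowed). At each pair, the students whose initial pair it is have priority over all other students, and ties are broken by a fixed strict master priority list of the students, common to all pairs. A student with initial pair $(c,t)$ is *permissible* to $(c',t')$ at a matching $X$ of the hypothetical market if $\xi(X)+\chi_{c',t'}-\chi_{c,t}\in\Xi\cap\Xi^0$, where $\xi(X)$ counts the students matched with each pair. In each step, let $X$ consist of the assignments made in earlier steps and of the initial pairs of all other students. Each remaining pair points to the unassigned student, among those permissible to it at $X$, who has the highest priority; pairs with no such student are removed permanently. Each unassigned student points to her highest-ranked remaining pair under $\tilde P_s$. Every student on a cycle is assigned the pair she points to and leaves the market. The algorithm stops in the first step after which no student remains; its outcome is the induced matching of students to schools. **Theorem.** Suppose that the initial matching satisfies $\Xi$ and that $\Xi\cap\Xi^0$ is M-convex. Then TTC is well defined (the algorithm stops at every preference profile) and its outcome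 at every preference profile $P$ is a feasible matching $X$ that satisfies 1. the policy goal: $\xi(X)\in\Xi$; 2. constrained efficiency: there is no feasible matching $Y$ with $\xi(Y)\in\Xi$ such that every student $s$ weakly prefers $Y$ to $X$ (under $R_s$) and at least one strictly does; 3. individual rationality: every student $s$ weakly prefers her outcome in $X$ to $c_0(s)$. Moreover TTC is strategy-proof: no student $s$ has, at any profile $P$, a report $P_s'$ whose outcome for her (the others reporting as in $P$) is strictly better under $P_s$ than her outcome at $P$. -/

import Mathlib

noncomputable section

namespace SchoolChoice

/-- A strict preference (or priority) order: an irreflexive, transitive relation in which any two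
distinct alternatives are comparable; `r.rel a b` means that `a` is ranked strictly above `b`. -/
structure StrictRanking (A : Type*) where
  rel : A → A → Prop
  irrefl : ∀ a, ¬ rel a a
  trans : ∀ a b c, rel a b → rel b c → rel a c
  connex : ∀ a b, a ≠ b → rel a b ∨ rel b a

/-- The weak order of a strict ranking. -/
def StrictRanking.weak {A : Type*} (r : StrictRanking A) (a b : A) : Prop :=
  r.rel a b ∨ a = b

/-- A preference of a student over all schools and the outside option `none` of being unmatched,
which is the least preferred outcome. -/
structure SchoolPref (C : Type*) extends StrictRanking (Option C) where
  outside_last : ∀ c : C, rel (some c) none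

/-- A distribution: the entry at `(c, t)` is the number of type-`t` students at school `c`. -/
abbrev Dist (C T : Type*) := C × T → ℕ

open Classical in
/-- The distribution with one student at the school-type pair `p` and no other students. -/
def chi {C T : Type*} (p : C × T) : Dist C T := fun r => if r = p then 1 else 0

/-- M-convexity of a set of distributions. Both subtractions are exact: `ξ p > ζ p ≥ 0`, so
`ξ p ≥ 1`, and `ζ r > ξ r ≥ 0`, so `ζ r ≥ 1`. -/
def MConvex {C T : Type*} (F : Set (Dist C T)) : Prop :=
  ∀ ξ ∈ F, ∀ ζ ∈ F, ∀ p, ζ p < ξ p →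
    ∃ r, ξ r < ζ r ∧ ξ - chi p + chi r ∈ F ∧ ζ + chi p - chi r ∈ F

/-- The data of a problem other than student preferences. The initial matching gives every student
exactly one school and respects the capacities. The district of a contract is that of its
school, so that a contract is a student-school pair. -/
structure Problem (S D C T : Type*) [Fintype S] where
  studentDistrict : S → D
  schoolDistrict : C → D
  typeOf : S → T
  capacity : C → ℕ
  initial : S → C
  initial_feasible : ∀ c, {s | initial s = c}.ncard ≤ capacity c

/-- A matching that is feasible for students: at most one contract for every student;
`none` means that the student is unmatched. -/
abbrev Matching (S C : Type*) := S → Option C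

/-- A preference profile. -/
abbrev Profile (S C : Type*) := S → SchoolPref C

/-- A mechanism maps preference profiles to matchings. -/
abbrev Mechanism (S C : Type*) := Profile S C → Matching S C

/-- `X` Pareto dominates `Y` at the profile `R`. -/
def ParetoDominates {S C : Type*} (R : Profile S C) (X Y : Matching S C) : Prop :=
  (∀ s, (R s).weak (X s) (Y s)) ∧ ∃ s, (R s).rel (X s) (Y s)

open Classical in
/-- No student can misreport her preference and get a strictly more preferred outcome. -/
def StrategyProof {S C : Type*} (φ : Mechanism S C) : Prop :=
  ∀ (R : Profile S C) (s : S), ¬ ∃ Q : SchoolPref C,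
    (R s).rel (φ (Function.update R s Q) s) (φ R s)

namespace Problem

variable {S D C T : Type*} [Fintype S] [Fintype D] [Fintype C] [Fintype T]

/-- The number of students whose home district is `d`. -/
def districtSize (P : Problem S D C T) (d : D) : ℕ := {s | P.studentDistrict s = d}.ncard

/-- The policy that every student is matched and no school exceeds its capacity. -/
def basicPolicy (P : Problem S D C T) : Set (Dist C T) :=
  {ξ | ∑ p, ξ p = ∑ d, P.districtSize d ∧ ∀ c, ∑ t, ξ (c, t) ≤ P.capacity c}

/-- The initial matching. -/
def initialMatching (P : Problem S D C T) : Matching S C := fun s => some (P.initial s)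

/-- No school is matched with more students than its capacity. -/
def Feasible (P : Problem S D C T) (X : Matching S C) : Prop :=
  ∀ c, {s | X s = some c}.ncard ≤ P.capacity c

/-- The distribution associated with a matching. -/
def dist (P : Problem S D C T) (X : Matching S C) : Dist C T :=
  fun p => {s | X s = some p.1 ∧ P.typeOf s = p.2}.ncard

/-- The matching satisfies the policy goal. -/
def SatisfiesPolicy (P : Problem S D C T) (Ξ : Set (Dist C T)) (X : Matching S C) : Prop :=
  P.dist X ∈ Ξ

/-- Every student weakly prefers her outcome to her initial school. -/
def IndividuallyRational (P : Problem S D C T) (R : Profile S C) (X : Matching S C) : Prop :=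
  ∀ s, (R s).weak (X s) (some (P.initial s))

/-- `X` is feasible, satisfies the policy goal, and is not Pareto dominated by a feasible matching
that satisfies the policy goal. -/
def ConstrainedEfficient (P : Problem S D C T) (Ξ : Set (Dist C T)) (R : Profile S C)
    (X : Matching S C) : Prop :=
  P.Feasible X ∧ P.SatisfiesPolicy Ξ X ∧
    ¬ ∃ Y : Matching S C, P.Feasible Y ∧ P.SatisfiesPolicy Ξ Y ∧ ParetoDominates R Y X

/-! The hypothetical market of students and school-type pairs -/

/-- The initial school-type pair of a student. -/
def initialPair (P : Problem S D C T) (s : S) : C × T := (P.initial s, P.typeOf s)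

/-- `Q` is a preference of student `s` over school-type pairs in the hypothetical market that is
derived from `R`: pairs of her own type are ranked as in `R`, and pairs of other types
are below her initial pair. -/
structure IsHypotheticalPref (P : Problem S D C T) (s : S) (R : SchoolPref C)
    (Q : StrictRanking (C × T)) : Prop where
  own_type : ∀ c c' : C,
    R.rel (some c) (some c') ↔ Q.rel (c, P.typeOf s) (c', P.typeOf s)
  other_type : ∀ (c : C) (t : T), t ≠ P.typeOf s → Q.rel (P.initialPair s) (c, t)

/-- Student `s` has higher priority than `s'` at the pair `p`: students initially matched with `p`
come before all others, and ties are broken by the master priority list. -/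
def HigherPriority (P : Problem S D C T) (master : StrictRanking S) (p : C × T)
    (s s' : S) : Prop :=
  (P.initialPair s = p ∧ P.initialPair s' ≠ p) ∨
    ((P.initialPair s = p ↔ P.initialPair s' = p) ∧ master.rel s s')

/-- The distribution of a matching of the hypothetical market. -/
def pairDist (Y : S → C × T) : Dist C T := fun p => {s | Y s = p}.ncard

/-- Student `s` is permissible to the pair `p` at the matching `Y`: the integer vector
`ξ(Y) + χ_p - χ_(initial pair of s)` is a distribution that satisfies the policy goal `Ξ` and
matches every student within the capacities. -/
def Permissible (P : Problem S D C T) (Ξ : Set (Dist C T)) (Y : S → C × T) (s : S)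
    (p : C × T) : Prop :=
  ∃ η ∈ Ξ ∩ P.basicPolicy, η + chi (P.initialPair s) = pairDist Y + chi p

/-- A state of the algorithm: the assignments made so far (`none` for the students who have not
been processed), and the school-type pairs that are still in the market. -/
structure TTCState (S C T : Type*) where
  assigned : S → Option (C × T)
  market : Set (C × T)

/-- The matching consisting of the assignments made so far and of the initial assignments of all
other students. -/
def current (P : Problem S D C T) (σ : TTCState S C T) : S → C × T :=
  fun s => (σ.assigned s).getD (P.initialPair s)

/-- The unassigned students who are permissible to `p`. -/
def candidates (P : Problem S D C T) (Ξ : Set (Dist C T)) (σ : TTCState S C T)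
    (p : C × T) : Set S :=
  {s | σ.assigned s = none ∧ P.Permissible Ξ (P.current σ) s p}

/-- The pairs that remain after those without a permissible unassigned student are removed. -/
def remainingPairs (P : Problem S D C T) (Ξ : Set (Dist C T)) (σ : TTCState S C T) :
    Set (C × T) :=
  {p | p ∈ σ.market ∧ (P.candidates Ξ σ p).Nonempty}

/-- A remaining pair points to the permissible unassigned student with the highest priority. -/
def PairPointsTo (P : Problem S D C T) (Ξ : Set (Dist C T)) (master : StrictRanking S)
    (σ : TTCState S C T) (p : C × T) (s : S) : Prop :=
  p ∈ P.remainingPairs Ξ σ ∧ s ∈ P.candidates Ξ σ p ∧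
    ∀ s' ∈ P.candidates Ξ σ p, s' ≠ s → P.HigherPriority master p s s'

/-- An unassigned student points to her highest ranked remaining pair. -/
def StudentPointsTo (P : Problem S D C T) (Ξ : Set (Dist C T))
    (Q : S → StrictRanking (C × T)) (σ : TTCState S C T) (s : S) (p : C × T) : Prop :=
  σ.assigned s = none ∧ p ∈ P.remainingPairs Ξ σ ∧
    ∀ p' ∈ P.remainingPairs Ξ σ, p' ≠ p → (Q s).rel p p'

/-- Student `s` is part of a cycle of the pointing graph. As every vertex points to at most one
vertex, this means that following the pointers from `s` leads back to `s`. -/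
def InCycle (P : Problem S D C T) (Ξ : Set (Dist C T)) (master : StrictRanking S)
    (Q : S → StrictRanking (C × T)) (σ : TTCState S C T) (s : S) : Prop :=
  Relation.TransGen
    (fun a b => ∃ p, P.StudentPointsTo Ξ Q σ a p ∧ P.PairPointsTo Ξ master σ p b) s s

open Classical in
/-- One step of the algorithm: pairs without a permissible student are removed, and all cycles
are executed. -/
def ttcStep (P : Problem S D C T) (Ξ : Set (Dist C T)) (master : StrictRanking S)
    (Q : S → StrictRanking (C × T)) (σ : TTCState S C T) : TTCState S C T where
  assigned s :=
    if h : P.InCycle Ξ master Q σ s ∧ ∃ p, P.StudentPointsTo Ξ Q σ s p then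
      some h.2.choose
    else σ.assigned s
  market := P.remainingPairs Ξ σ

/-- The state after `n` steps. At the start no student is assigned and all pairs are in the
market. -/
def ttcState (P : Problem S D C T) (Ξ : Set (Dist C T)) (master : StrictRanking S)
    (Q : S → StrictRanking (C × T)) (n : ℕ) : TTCState S C T :=
  (P.ttcStep Ξ master Q)^[n] ⟨fun _ => none, Set.univ⟩

/-- No student remains to be processed after `n` steps. -/
def DoneAfter (P : Problem S D C T) (Ξ : Set (Dist C T)) (master : StrictRanking S)
    (Q : S → StrictRanking (C × T)) (n : ℕ) : Prop :=
  ∀ s, (P.ttcState Ξ master Q n).assigned s ≠ none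

/-- The top trading cycles mechanism: it forms the preferences `hyp s (R s)` over school-type pairs,
runs the algorithm until the first step after which no student remains, and returns the induced
student-school matching. -/
def ttc (P : Problem S D C T) (Ξ : Set (Dist C T)) (master : StrictRanking S)
    (hyp : S → SchoolPref C → StrictRanking (C × T)) : Mechanism S C :=
  fun R s =>
    ((P.ttcState Ξ master (fun i => hyp i (R i))
      (sInf {n | P.DoneAfter Ξ master (fun i => hyp i (R i)) n})).assigned s).map Prod.fst

end Problem

end SchoolChoice

end

/-!
Permissibility of a student to a pair depends only on her initial pair, and the priorities come
from one master list. Hence every pair points to the first student on the list within some class of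
students with equal initial pairs, a pair that is the initial pair of an unassigned student points
to such a student, and any other pair `p` points to the first permissible student, so that nobody
higher on the list is permissible to `p`. Let a step move the students `u` on cycles, and let
`pr u` be the pair pointing to `u`. The step changes the distribution by the sum of the exchanges of
the initial pair of `u` for `pr u`, where only those with `pr u` different from the initial pair
matter. Each of them is possible on its own, and numbered by the master
list they are triangular: the initial pair of a higher student cannot be exchanged for `pr u`. For
an M-convex set, triangular exchanges are simultaneously possible (`MConvex.exists_sum_exchange`),
so the current matching stays within the policy goal (`IsConsistent.ttcStep`).

Efficiency rests on `candidates_nonempty_of_completion`: a pair without a permissible unassigned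
student is used by no allowed completion of the assignments made so far. In particular the removal
of pairs loses nothing, and by induction on the steps a Pareto improvement has to coincide with the
outcome. Individual rationality holds because the initial pair of an unassigned student is always
remaining. It also forces outcomes to have the student's own type, so that the pairs translate back
into schools.

For strategy-proofness, a pair keeps pointing to the same student until she is assigned
(`PairPointsTo.ttcStep`). She stays permissible because her exchange can be added to the triangular
family of the step, and nobody of higher priority becomes permissible by
`MConvex.not_exchangeable_after`. So if a misreport of `s` closes a cycle through a pair `y`, then
under her true report the chain of pointers from `y` to `s` persists until `s` is assigned, and `y`
is available to her at that time (`weak_of_misreport`).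
-/

namespace SchoolChoice

/-! ### Strict rankings of finite sets -/

namespace StrictRanking

variable {A : Type*}

theorem asymm (r : StrictRanking A) {a b : A} (h : r.rel a b) : ¬ r.rel b a :=
  fun h' => r.irrefl a (r.trans _ _ _ h h')

theorem exists_top (r : StrictRanking A) (s : Set A) (hs : s.Finite) (hne : s.Nonempty) :
    ∃ a ∈ s, ∀ b ∈ s, b ≠ a → r.rel a b := by
  induction s, hs using Set.Finite.induction_on with
  | empty => exact absurd hne Set.not_nonempty_empty
  | @insert a s _ _ ih =>
    rcases s.eq_empty_or_nonempty with rfl | hs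
    · exact ⟨a, by simp, by simp +contextual⟩
    · obtain ⟨m, hm, hmax⟩ := ih hs
      by_cases ham : a = m
      · subst ham
        exact ⟨a, by simp, fun b hb hba => hmax b (by simpa [hba] using hb) hba⟩
      rcases r.connex a m ham with h | h
      · refine ⟨a, by simp, fun b hb hba => ?_⟩
        by_cases hbm : b = m
        · exact hbm ▸ h
        · exact r.trans _ _ _ h (hmax b (by simpa [hba] using hb) hbm)
      · refine ⟨m, by simp [hm], fun b hb hbm => ?_⟩
        rcases hb with rfl | hb
        · exact h
        · exact hmax b hb hbm

/-- The number of alternatives ranked above `a`: the ranking as a numbering, the top one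
being `0`. -/
noncomputable def rank (r : StrictRanking A) (a : A) : ℕ := {b | r.rel b a}.ncard

theorem rank_lt_rank [Finite A] (r : StrictRanking A) {a b : A} :
    r.rank a < r.rank b ↔ r.rel a b := by
  have mono : ∀ {a b : A}, r.rel a b → r.rank a < r.rank b := fun {a b} h =>
    Set.ncard_lt_ncard ⟨fun c hc => r.trans _ _ _ hc h, fun hs => r.irrefl a (hs h)⟩
      (Set.toFinite _)
  refine ⟨fun h => ?_, mono⟩
  have hne : a ≠ b := by rintro rfl; exact lt_irrefl _ h
  exact (r.connex a b hne).resolve_right fun h' => lt_asymm h (mono h')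

theorem rank_injective [Finite A] (r : StrictRanking A) : Function.Injective r.rank := by
  intro a b h
  by_contra hne
  rcases r.connex a b hne with h' | h' <;> have := r.rank_lt_rank.2 h' <;> omega

end StrictRanking

/-! ### Exchanges in M-convex sets -/

section Exchange

variable {C T : Type*}

@[simp] theorem chi_self (p : C × T) : chi p p = 1 := by simp [chi]

theorem chi_of_ne {p r : C × T} (h : r ≠ p) : chi p r = 0 := by simp [chi, h]

theorem sum_chi_apply_eq_zero {ι : Type*} {W : Finset ι} {q : ι → C × T} {r : C × T}
    (h : ∀ w ∈ W, r ≠ q w) : (∑ w ∈ W, chi (q w)) r = 0 := by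
  rw [Finset.sum_apply]
  exact Finset.sum_eq_zero fun w hw => chi_of_ne (h w hw)

/-- `Exchangeable F ξ q p`: the vector `ξ - χ_q + χ_p` lies in `F`. The subtraction is moved to the
other side, so that it is exact. -/
def Exchangeable (F : Set (Dist C T)) (ξ : Dist C T) (q p : C × T) : Prop :=
  ∃ η ∈ F, η + chi q = ξ + chi p

variable {F : Set (Dist C T)}

theorem exchangeable_self {ξ : Dist C T} (h : ξ ∈ F) (p : C × T) : Exchangeable F ξ p p :=
  ⟨ξ, h, rfl⟩

theorem MConvex.exists_exchangeable (hM : MConvex F) {ξ ζ : Dist C T} (hξ : ξ ∈ F) (hζ : ζ ∈ F)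
    {p : C × T} (h : ζ p < ξ p) :
    ∃ r, ξ r < ζ r ∧ Exchangeable F ξ p r ∧ Exchangeable F ζ r p := by
  obtain ⟨r, hr, h₁, h₂⟩ := hM ξ hξ ζ hζ p h
  refine ⟨r, hr, ⟨_, h₁, ?_⟩, ⟨_, h₂, ?_⟩⟩ <;> ext x <;>
    simp only [Pi.add_apply, Pi.sub_apply, chi] <;> split_ifs <;> subst_vars <;> omega

/-- Exchanges that are possible one at a time are possible simultaneously if they are triangular:
numbered by `k`, an earlier removal `q v` is never exchangeable with a later addition `p w`. -/
theorem MConvex.exists_sum_exchange (hM : MConvex F) {ξ : Dist C T} (hξ : ξ ∈ F) {ι : Type*}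
    (p q : ι → C × T) (k : ι → ℕ) (W : Finset ι)
    (hpq : ∀ v ∈ W, ∀ w ∈ W, p v ≠ q w) (hq : Set.InjOn q W) (hk : Set.InjOn k W)
    (hex : ∀ w ∈ W, Exchangeable F ξ (q w) (p w))
    (htri : ∀ v ∈ W, ∀ w ∈ W, k v < k w → ¬ Exchangeable F ξ (q v) (p w)) :
    ∃ ζ ∈ F, ζ + ∑ w ∈ W, chi (q w) = ξ + ∑ w ∈ W, chi (p w) := by
  classical
  induction W using Finset.induction_on_max_value k with
  | empty => exact ⟨ξ, hξ, by simp⟩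
  | insert u W hu hmax ih =>
    have hW : ∀ {w}, w ∈ W → w ∈ insert u W := fun h => Finset.mem_insert_of_mem h
    have huW : u ∈ insert u W := Finset.mem_insert_self u W
    have hsub : (W : Set ι) ⊆ (insert u W : Finset ι) := fun w h => hW h
    obtain ⟨ζ, hζ, hsum⟩ := ih (fun v hv w hw => hpq v (hW hv) w (hW hw)) (hq.mono hsub)
      (hk.mono hsub) (fun w hw => hex w (hW hw))
      (fun v hv w hw => htri v (hW hv) w (hW hw))
    obtain ⟨ζ', hζ', hsum'⟩ := hex u huW
    have hne : p u ≠ q u := hpq u huW u huW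
    have hlt : ζ' (q u) < ζ (q u) := by
      have h₁ := congrFun hsum (q u)
      have h₂ := congrFun hsum' (q u)
      simp only [Pi.add_apply, chi_self, chi_of_ne hne.symm] at h₁ h₂
      rw [sum_chi_apply_eq_zero fun w hw h => hu (hq huW (hW hw) h ▸ hw),
        sum_chi_apply_eq_zero fun w hw h => hpq w (hW hw) u huW h.symm] at h₁
      omega
    obtain ⟨r, hr, ⟨θ, hθ, hsumθ⟩, ⟨θ', hθ', hsumθ'⟩⟩ := hM.exists_exchangeable hζ hζ' hlt
    have hrp : r = p u := by
      by_contra hrp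
      have h₁ := congrFun hsum r
      have h₂ := congrFun hsum' r
      simp only [Pi.add_apply, chi_of_ne hrp] at h₁ h₂
      have hv : ∃ v ∈ W, r = q v := by
        by_contra! hno
        rw [sum_chi_apply_eq_zero hno] at h₁
        omega
      obtain ⟨v, hv, rfl⟩ := hv
      have hvu : k v < k u := lt_of_le_of_ne (hmax v hv) fun h =>
        hu (hk (hW hv) huW h ▸ hv)
      exact htri v (hW hv) u huW hvu ⟨θ', hθ', hsumθ'.trans hsum'⟩
    subst hrp
    refine ⟨θ, hθ, ?_⟩
    rw [Finset.sum_insert hu, Finset.sum_insert hu, ← add_assoc, hsumθ, add_right_comm, hsum]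
    abel

/-- After the triangular exchanges of `exists_sum_exchange`, the pair `b`, which is numbered `n`,
cannot be exchanged with `a` either, if neither `b` nor any of the removals numbered below `n`
could be exchanged with `a` before, and the additions numbered above `n` could not be exchanged
with `b`. -/
theorem MConvex.not_exchangeable_after (hM : MConvex F) {ξ ξ' : Dist C T} (hξ : ξ ∈ F)
    {ι : Type*} (p q : ι → C × T) (k : ι → ℕ) (W : Finset ι)
    (hpq : ∀ v ∈ W, ∀ w ∈ W, p v ≠ q w) (hq : Set.InjOn q W) (hk : Set.InjOn k W)
    (hex : ∀ w ∈ W, Exchangeable F ξ (q w) (p w))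
    (htri : ∀ v ∈ W, ∀ w ∈ W, k v < k w → ¬ Exchangeable F ξ (q v) (p w))
    (hsum : ξ' + ∑ w ∈ W, chi (q w) = ξ + ∑ w ∈ W, chi (p w))
    {a b : C × T} {n : ℕ} (hn : ∀ w ∈ W, k w ≠ n) (hab : a ≠ b) (haq : ∀ w ∈ W, a ≠ q w)
    (hpb : ∀ w ∈ W, p w ≠ b) (hba : ¬ Exchangeable F ξ b a)
    (hqa : ∀ w ∈ W, k w < n → ¬ Exchangeable F ξ (q w) a)
    (hbp : ∀ w ∈ W, n < k w → ¬ Exchangeable F ξ b (p w)) :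
    ¬ Exchangeable F ξ' b a := by
  classical
  rintro ⟨η, hη, hsumη⟩
  -- Only the exchanges numbered below `n` are carried out at first, which leads to `ζ`.
  set H := W.filter (fun w => k w < n)
  set L := W.filter (fun w => ¬ k w < n)
  have hH : ∀ {w}, w ∈ H → w ∈ W ∧ k w < n := fun h => Finset.mem_filter.1 h
  have hL : ∀ {w}, w ∈ L → w ∈ W ∧ n < k w := fun {w} h => by
    have h' := Finset.mem_filter.1 h
    have := hn w h'.1
    exact ⟨h'.1, by omega⟩
  have hsub : (H : Set ι) ⊆ W := fun w h => (hH h).1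
  obtain ⟨ζ, hζ, hsumζ⟩ := hM.exists_sum_exchange hξ p q k H
    (fun v hv w hw => hpq v (hH hv).1 w (hH hw).1) (hq.mono hsub) (hk.mono hsub)
    (fun w hw => hex w (hH hw).1) (fun v hv w hw => htri v (hH hv).1 w (hH hw).1)
  have key : ∀ y, y ≠ b → (∀ w ∈ H, y ≠ q w) → ¬ Exchangeable F ξ b y →
      (∀ w ∈ H, ¬ Exchangeable F ξ (q w) y) → ¬ Exchangeable F ζ b y := by
    rintro y hyb hyq hξb hξq ⟨θ, hθ, hsumθ⟩
    have hlt : ξ y < θ y := by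
      have h₁ := congrFun hsumθ y
      have h₂ := congrFun hsumζ y
      simp only [Pi.add_apply, chi_self, chi_of_ne hyb] at h₁ h₂
      rw [sum_chi_apply_eq_zero hyq] at h₂
      omega
    obtain ⟨r, hr, -, hex⟩ := hM.exists_exchangeable hθ hξ hlt
    have hrb : r ≠ b := by rintro rfl; exact hξb hex
    have hrq : ∀ w ∈ H, r ≠ q w := by rintro w hw rfl; exact hξq w hw hex
    have h₁ := congrFun hsumθ r
    have h₂ := congrFun hsumζ r
    simp only [Pi.add_apply, chi_of_ne hrb] at h₁ h₂
    rw [sum_chi_apply_eq_zero hrq] at h₂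
    omega
  have hsplit : ∀ f : ι → Dist C T, ∑ w ∈ W, f w = ∑ w ∈ H, f w + ∑ w ∈ L, f w :=
    fun f => (Finset.sum_filter_add_sum_filter_not W _ f).symm
  rw [hsplit, hsplit] at hsum
  have htot : ∀ x, η x + chi b x + (∑ w ∈ L, chi (q w)) x
      = ζ x + chi a x + (∑ w ∈ L, chi (p w)) x := fun x => by
    have h₁ := congrFun hsum x
    have h₂ := congrFun hsumζ x
    have h₃ := congrFun hsumη x
    simp only [Pi.add_apply] at h₁ h₂ h₃
    omega
  have hlt : η b < ζ b := by
    have h := htot b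
    rw [chi_self, chi_of_ne hab.symm,
      sum_chi_apply_eq_zero (q := p) fun w hw => (hpb w (hL hw).1).symm] at h
    omega
  obtain ⟨r, hr, hexr, -⟩ := hM.exists_exchangeable hζ hη hlt
  have hra : r ≠ a := by
    rintro rfl
    exact key r hab (fun w hw => haq w (hH hw).1) hba (fun w hw => hqa w (hH hw).1 (hH hw).2) hexr
  have hrp : ∀ w ∈ L, r ≠ p w := by
    rintro w hw rfl
    obtain ⟨hwW, hnw⟩ := hL hw
    exact key _ (hpb w hwW) (fun v hv => hpq w hwW v (hH hv).1) (hbp w hwW hnw)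
      (fun v hv => htri v (hH hv).1 w hwW ((hH hv).2.trans hnw)) hexr
  have h := htot r
  rw [chi_of_ne hra, sum_chi_apply_eq_zero hrp] at h
  omega

end Exchange

/-! ### Walks in pointing graphs -/

section Walks

open Relation

variable {S : Type*} {r r' : S → S → Prop}

theorem exists_transGen_self [Finite S] (U : Set S) (hne : U.Nonempty)
    (h : ∀ a ∈ U, ∃ b ∈ U, r a b) : ∃ a, TransGen r a a := by
  by_contra! hirr
  let gt : S → S → Prop := fun a b => TransGen r b a
  have : IsTrans S gt := ⟨fun a b c hab hbc => TransGen.trans hbc hab⟩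
  have : Std.Irrefl gt := ⟨hirr⟩
  obtain ⟨a, ha, hmin⟩ := (Finite.wellFounded_of_trans_of_irrefl gt).has_min U hne
  obtain ⟨b, hb, hab⟩ := h a ha
  exact hmin b hb (TransGen.single hab)

/-- If every vertex has at most one successor, then a walk that starts on a cycle stays on it. -/
theorem transGen_self_of_reflTransGen (hr : ∀ a b c, r a b → r a c → b = c) {a s : S}
    (hs : ReflTransGen r a s) (ha : TransGen r a a) : TransGen r s s := by
  induction hs with
  | refl => exact ha
  | @tail b c _ hbc ih =>
    obtain ⟨d, hbd, hdb⟩ := TransGen.head'_iff.1 ih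
    obtain rfl := hr b c d hbc hbd
    exact TransGen.tail' hdb hbc

theorem reflTransGen_congr_off {s : S} (h : ∀ a b, a ≠ s → r a b → r' a b) {a : S}
    (ha : ReflTransGen r a s) : ReflTransGen r' a s := by
  induction ha using ReflTransGen.head_induction_on with
  | refl => exact .refl
  | @head a b hab _ ih =>
    by_cases has : a = s
    · exact has ▸ .refl
    · exact .head (h a b has hab) ih

theorem transGen_congr_off {s : S} (h : ∀ a b, a ≠ s → r a b → r' a b) (hs : ¬ TransGen r s s)
    {t : S} (ht : TransGen r t t) : TransGen r' t t := by
  have key : ∀ b, TransGen r t b → TransGen r' t b ∨ (ReflTransGen r t s ∧ TransGen r s b) := by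
    intro b hb
    induction hb with
    | @single b hab =>
      by_cases hts : t = s
      · exact .inr ⟨hts ▸ .refl, hts ▸ .single hab⟩
      · exact .inl (.single (h _ _ hts hab))
    | @tail b c hab hbc ih =>
      rcases ih with ih | ⟨h₁, h₂⟩
      · by_cases hbs : b = s
        · exact .inr ⟨hbs ▸ hab.to_reflTransGen, hbs ▸ .single hbc⟩
        · exact .inl (ih.tail (h _ _ hbs hbc))
      · exact .inr ⟨h₁, h₂.tail hbc⟩
  exact (key t ht).resolve_right fun ⟨h₁, h₂⟩ => hs (h₂.trans_left h₁)

end Walks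

namespace Problem

variable {S D C T : Type*} [Fintype S]

/-! ### From school-type pairs to schools -/

section

variable {P : Problem S D C T}

theorem IsHypotheticalPref.snd_eq {s : S} {R : SchoolPref C} {q : StrictRanking (C × T)}
    (hq : P.IsHypotheticalPref s R q) {p : C × T} (h : q.weak p (P.initialPair s)) :
    p.2 = P.typeOf s := by
  by_contra hne
  have h' := hq.other_type p.1 p.2 hne
  rcases h with h | rfl
  · exact q.asymm h h'
  · exact q.irrefl _ h'

theorem IsHypotheticalPref.weak_iff {s : S} {R : SchoolPref C} {q : StrictRanking (C × T)}
    (hq : P.IsHypotheticalPref s R q) {p p' : C × T} (hp : p.2 = P.typeOf s)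
    (hp' : p'.2 = P.typeOf s) : q.weak p p' ↔ R.weak (some p.1) (some p'.1) := by
  obtain ⟨c, t⟩ := p
  obtain ⟨c', t'⟩ := p'
  simp only at hp hp'
  subst hp hp'
  simp [StrictRanking.weak, hq.own_type]

theorem dist_eq_pairDist {X : Matching S C} {Y : S → C × T}
    (h : ∀ s, X s = some (Y s).1 ∧ (Y s).2 = P.typeOf s) : P.dist X = pairDist Y := by
  ext p
  simp only [dist, pairDist]
  congr 1
  ext s
  simp [(h s).1, ← (h s).2, Prod.ext_iff]

/-! ### The current matching and its distribution -/

theorem pairDist_eq_sum (Y : S → C × T) : pairDist Y = ∑ s, chi (Y s) := by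
  classical
  ext p
  simp [pairDist, Finset.sum_apply, chi, Finset.sum_boole, Set.ncard_eq_toFinset_card', eq_comm]

theorem current_of_unassigned {s : S} {σ : TTCState S C T} (h : σ.assigned s = none) :
    P.current σ s = P.initialPair s := by simp [current, h]

theorem current_of_assigned {s : S} {p : C × T} {σ : TTCState S C T} (h : σ.assigned s = some p) :
    P.current σ s = p := by simp [current, h]

end

variable [Fintype D] [Fintype C] [Fintype T]
  {P : Problem S D C T} {Ξ : Set (Dist C T)} {master : StrictRanking S}
  {Q Q' : S → StrictRanking (C × T)} {σ : TTCState S C T}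

/-! ### Pointers -/

/-- The priority order of the students at the pair `p`. -/
def priority (P : Problem S D C T) (master : StrictRanking S) (p : C × T) : StrictRanking S where
  rel := P.HigherPriority master p
  irrefl a := by
    have := master.irrefl a
    simp only [HigherPriority]
    tauto
  trans a b c := by
    have := master.trans a b c
    simp only [HigherPriority]
    tauto
  connex a b h := by
    have := master.connex a b h
    simp only [HigherPriority]
    tauto

theorem PairPointsTo.unassigned {p : C × T} {s : S} (h : P.PairPointsTo Ξ master σ p s) :
    σ.assigned s = none := h.2.1.1

theorem PairPointsTo.unique {p : C × T} {s s' : S} (h : P.PairPointsTo Ξ master σ p s)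
    (h' : P.PairPointsTo Ξ master σ p s') : s = s' := by
  by_contra hne
  exact (P.priority master p).asymm (h.2.2 s' h'.2.1 (Ne.symm hne)) (h'.2.2 s h.2.1 hne)

theorem StudentPointsTo.unique {s : S} {p p' : C × T} (h : P.StudentPointsTo Ξ Q σ s p)
    (h' : P.StudentPointsTo Ξ Q σ s p') : p = p' := by
  by_contra hne
  exact (Q s).asymm (h.2.2 p' h'.2.1 (Ne.symm hne)) (h'.2.2 p h.2.1 hne)

theorem StudentPointsTo.weak {s : S} {p p' : C × T} (h : P.StudentPointsTo Ξ Q σ s p)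
    (h' : p' ∈ P.remainingPairs Ξ σ) : (Q s).weak p p' := by
  by_cases hne : p' = p
  · exact .inr hne.symm
  · exact .inl (h.2.2 p' h' hne)

theorem exists_pairPointsTo {p : C × T} (h : p ∈ P.remainingPairs Ξ σ) :
    ∃ s, P.PairPointsTo Ξ master σ p s := by
  obtain ⟨s, hs, htop⟩ := (P.priority master p).exists_top _ (Set.toFinite _) h.2
  exact ⟨s, h, hs, htop⟩

theorem exists_studentPointsTo {s : S} (h : σ.assigned s = none)
    (hne : (P.remainingPairs Ξ σ).Nonempty) : ∃ p, P.StudentPointsTo Ξ Q σ s p := by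
  obtain ⟨p, hp, htop⟩ := (Q s).exists_top _ (Set.toFinite _) hne
  exact ⟨p, h, hp, htop⟩

/-- A pair points to the first student on the master list among the unassigned students who have
the same initial pair as the student pointed to. -/
theorem PairPointsTo.master_rel {p : C × T} {s v : S} (h : P.PairPointsTo Ξ master σ p s)
    (hv : σ.assigned v = none) (hvs : P.initialPair v = P.initialPair s) (hne : v ≠ s) :
    master.rel s v := by
  have hcand : v ∈ P.candidates Ξ σ p := ⟨hv, by
    have := h.2.1.2
    unfold Permissible at this ⊢
    rwa [hvs]⟩
  rcases h.2.2 v hcand hne with ⟨h₁, h₂⟩ | ⟨-, h₂⟩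
  · exact absurd (hvs.trans h₁) h₂
  · exact h₂

/-- A pair that is the initial pair of an unassigned student points to such a student. -/
theorem PairPointsTo.initialPair_eq (hσ : pairDist (P.current σ) ∈ Ξ ∩ P.basicPolicy)
    {p : C × T} {s v : S} (h : P.PairPointsTo Ξ master σ p s)
    (hv : σ.assigned v = none) (hvp : P.initialPair v = p) : P.initialPair s = p := by
  by_cases hne : v = s
  · exact hne ▸ hvp
  · have hcand : v ∈ P.candidates Ξ σ p := ⟨hv, hvp ▸ exchangeable_self hσ _⟩
    rcases h.2.2 v hcand hne with ⟨h₁, -⟩ | ⟨h₁, -⟩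
    · exact h₁
    · exact h₁.2 hvp

theorem PairPointsTo.not_exchangeable {p : C × T} {s v : S}
    (h : P.PairPointsTo Ξ master σ p s) (hs : P.initialPair s ≠ p) (hv : σ.assigned v = none)
    (hvs : master.rel v s) :
    ¬ Exchangeable (Ξ ∩ P.basicPolicy) (pairDist (P.current σ)) (P.initialPair v) p := by
  intro hex
  have hne : v ≠ s := by rintro rfl; exact master.irrefl _ hvs
  rcases h.2.2 v ⟨hv, hex⟩ hne with ⟨h₁, -⟩ | ⟨-, h₁⟩
  · exact hs h₁
  · exact master.asymm hvs h₁

/-! ### One step of the algorithm -/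

/-- `Follows s s'`: the pair to which `s` points points to `s'`. -/
def Follows (P : Problem S D C T) (Ξ : Set (Dist C T)) (master : StrictRanking S)
    (Q : S → StrictRanking (C × T)) (σ : TTCState S C T) (s s' : S) : Prop :=
  ∃ p, P.StudentPointsTo Ξ Q σ s p ∧ P.PairPointsTo Ξ master σ p s'

theorem Follows.unique {s a b : S} (ha : P.Follows Ξ master Q σ s a)
    (hb : P.Follows Ξ master Q σ s b) : a = b := by
  obtain ⟨p, hp, hpa⟩ := ha
  obtain ⟨p', hp', hpb⟩ := hb
  obtain rfl := hp.unique hp'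
  exact hpa.unique hpb

theorem InCycle.exists_studentPointsTo {s : S} (h : P.InCycle Ξ master Q σ s) :
    ∃ p, P.StudentPointsTo Ξ Q σ s p := by
  obtain ⟨_, ⟨p, hp, -⟩, -⟩ := Relation.TransGen.head'_iff.1 h
  exact ⟨p, hp⟩

theorem InCycle.unassigned {s : S} (h : P.InCycle Ξ master Q σ s) : σ.assigned s = none :=
  h.exists_studentPointsTo.choose_spec.1

theorem InCycle.exists_pred {s : S} (h : P.InCycle Ξ master Q σ s) :
    ∃ a, P.InCycle Ξ master Q σ a ∧ P.Follows Ξ master Q σ a s := by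
  obtain ⟨a, hsa, has⟩ := Relation.TransGen.tail'_iff.1 h
  exact ⟨a, Relation.TransGen.head' has hsa, has⟩

theorem InCycle.assigned_ttcStep {s : S} {p : C × T} (h : P.InCycle Ξ master Q σ s)
    (hp : P.StudentPointsTo Ξ Q σ s p) : (P.ttcStep Ξ master Q σ).assigned s = some p := by
  have h' : P.InCycle Ξ master Q σ s ∧ ∃ p, P.StudentPointsTo Ξ Q σ s p := ⟨h, p, hp⟩
  simp only [ttcStep, dif_pos h']
  exact congrArg some (h'.2.choose_spec.unique hp)

theorem assigned_ttcStep_of_not_inCycle {s : S} (h : ¬ P.InCycle Ξ master Q σ s) :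
    (P.ttcStep Ξ master Q σ).assigned s = σ.assigned s := by
  simp [ttcStep, h]

theorem assigned_ttcStep_of_eq_some {s : S} {p : C × T} (h : σ.assigned s = some p) :
    (P.ttcStep Ξ master Q σ).assigned s = some p := by
  rw [assigned_ttcStep_of_not_inCycle, h]
  intro hc
  simp [hc.unassigned] at h

theorem unassigned_of_ttcStep {s : S} (h : (P.ttcStep Ξ master Q σ).assigned s = none) :
    σ.assigned s = none ∧ ¬ P.InCycle Ξ master Q σ s := by
  have hc : ¬ P.InCycle Ξ master Q σ s := fun hc => by
    obtain ⟨p, hp⟩ := hc.exists_studentPointsTo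
    simp [hc.assigned_ttcStep hp] at h
  exact ⟨by rwa [assigned_ttcStep_of_not_inCycle hc] at h, hc⟩

theorem assigned_ttcStep_eq_some {s : S} {p : C × T}
    (h : (P.ttcStep Ξ master Q σ).assigned s = some p) :
    σ.assigned s = some p ∨ (P.InCycle Ξ master Q σ s ∧ P.StudentPointsTo Ξ Q σ s p) := by
  by_cases hc : P.InCycle Ξ master Q σ s
  · obtain ⟨p', hp'⟩ := hc.exists_studentPointsTo
    rw [hc.assigned_ttcStep hp', Option.some_inj] at h
    exact .inr ⟨hc, h ▸ hp'⟩
  · exact .inl (by rwa [assigned_ttcStep_of_not_inCycle hc] at h)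

/-- The effect of one step on the distribution. Every student `u` on a cycle is indexed with the
pair `pr u` that points to her on that cycle; the change of the distribution is the sum of the
exchanges of `initialPair u` for `pr u`, where those that change nothing are left out. -/
theorem exists_pairDist_ttcStep (P : Problem S D C T) (Ξ : Set (Dist C T))
    (master : StrictRanking S) (Q : S → StrictRanking (C × T)) (σ : TTCState S C T) :
    ∃ (W : Finset S) (pr : S → C × T),
      (∀ u ∈ W, P.InCycle Ξ master Q σ u ∧ P.PairPointsTo Ξ master σ (pr u) u ∧
        P.initialPair u ≠ pr u) ∧
      pairDist (P.current (P.ttcStep Ξ master Q σ)) + ∑ u ∈ W, chi (P.initialPair u)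
        = pairDist (P.current σ) + ∑ u ∈ W, chi (pr u) := by
  classical
  set σ' := P.ttcStep Ξ master Q σ with hσ'
  set Z : Finset S := Finset.univ.filter (P.InCycle Ξ master Q σ)
  have hZ : ∀ {s}, s ∈ Z ↔ P.InCycle Ξ master Q σ s := by simp [Z]
  have hpt : ∀ s ∈ Z, P.StudentPointsTo Ξ Q σ s (P.current σ' s) := fun s hs => by
    obtain ⟨p, hp⟩ := (hZ.1 hs).exists_studentPointsTo
    rwa [current_of_assigned ((hZ.1 hs).assigned_ttcStep hp)]
  have hpred : ∀ u, ∃ a, u ∈ Z → a ∈ Z ∧ P.PairPointsTo Ξ master σ (P.current σ' a) u := by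
    intro u
    by_cases hu : u ∈ Z
    · obtain ⟨a, ha, p, hap, hpu⟩ := (hZ.1 hu).exists_pred
      exact ⟨a, fun _ => ⟨hZ.2 ha, hap.unique (hpt a (hZ.2 ha)) ▸ hpu⟩⟩
    · exact ⟨u, fun h => absurd h hu⟩
  choose pd hpd using hpred
  have hinj : Set.InjOn pd Z := fun u hu v hv h =>
    (hpd u hu).2.unique (h ▸ (hpd v hv).2)
  have hmaps : Set.MapsTo pd Z Z := fun u hu => (hpd u hu).1
  have hsurj : Set.SurjOn pd Z Z := Finset.surjOn_of_injOn_of_card_le pd hmaps hinj le_rfl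
  have hsum : ∑ u ∈ Z, chi (P.current σ' (pd u)) = ∑ s ∈ Z, chi (P.current σ' s) :=
    Finset.sum_nbij pd hmaps hinj hsurj fun _ _ => rfl
  have htot : pairDist (P.current σ') + ∑ u ∈ Z, chi (P.initialPair u)
      = pairDist (P.current σ) + ∑ u ∈ Z, chi (P.current σ' (pd u)) := by
    have hin : ∑ s ∈ Z, chi (P.current σ s) = ∑ s ∈ Z, chi (P.initialPair s) :=
      Finset.sum_congr rfl fun s hs => by rw [current_of_unassigned (hZ.1 hs).unassigned]
    have hout : ∑ s ∈ Zᶜ, chi (P.current σ' s) = ∑ s ∈ Zᶜ, chi (P.current σ s) :=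
      Finset.sum_congr rfl fun s hs => by
        have : ¬ P.InCycle Ξ master Q σ s := fun h => Finset.mem_compl.1 hs (hZ.2 h)
        simp only [current, hσ', assigned_ttcStep_of_not_inCycle this]
    rw [pairDist_eq_sum, pairDist_eq_sum, ← Finset.sum_add_sum_compl Z,
      ← Finset.sum_add_sum_compl Z (fun s => chi (P.current σ s)), hsum, hin, hout]
    abel
  refine ⟨Z.filter fun u => P.initialPair u ≠ P.current σ' (pd u), fun u => P.current σ' (pd u),
    fun u hu => ?_, ?_⟩
  · obtain ⟨hu, hne⟩ := Finset.mem_filter.1 hu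
    exact ⟨hZ.1 hu, (hpd u hu).2, hne⟩
  · have hcancel : ∑ u ∈ Z with ¬ P.initialPair u ≠ P.current σ' (pd u), chi (P.initialPair u)
        = ∑ u ∈ Z with ¬ P.initialPair u ≠ P.current σ' (pd u), chi (P.current σ' (pd u)) :=
      Finset.sum_congr rfl fun u hu => by rw [not_not.1 (Finset.mem_filter.1 hu).2]
    rw [← Finset.sum_filter_add_sum_filter_not Z
        (fun u => P.initialPair u ≠ P.current σ' (pd u)) (fun u => chi (P.initialPair u)),
      ← Finset.sum_filter_add_sum_filter_not Z
        (fun u => P.initialPair u ≠ P.current σ' (pd u)), hcancel, ← add_assoc, ← add_assoc] at htot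
    exact add_right_cancel htot

/-- If `Y` completes the assignments made so far to a matching whose distribution is allowed, then
the pair `Y s` of an unassigned student `s` has a permissible unassigned student. Hence the
removed pairs are of no use for any completion. -/
theorem candidates_nonempty_of_completion (hM : MConvex (Ξ ∩ P.basicPolicy))
    (hσ : pairDist (P.current σ) ∈ Ξ ∩ P.basicPolicy) {Y : S → C × T}
    (hY : pairDist Y ∈ Ξ ∩ P.basicPolicy) (hext : ∀ s p, σ.assigned s = some p → Y s = p)
    {s : S} (hs : σ.assigned s = none) : (P.candidates Ξ σ (Y s)).Nonempty := by
  have hagree : ∀ {v}, Y v ≠ P.current σ v → σ.assigned v = none := fun {v} h => by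
    by_contra hv
    obtain ⟨p, hp⟩ := Option.ne_none_iff_exists'.1 hv
    exact h ((hext v p hp).trans (current_of_assigned hp).symm)
  by_cases hown : ∃ v, σ.assigned v = none ∧ P.initialPair v = Y s
  · obtain ⟨v, hv, hvs⟩ := hown
    exact ⟨v, hv, hvs ▸ exchangeable_self hσ _⟩
  · have hlt : pairDist (P.current σ) (Y s) < pairDist Y (Y s) := by
      refine Set.ncard_lt_ncard ⟨fun v (hv : P.current σ v = Y s) => ?_, fun hsub => ?_⟩
        (Set.toFinite _)
      · by_contra hne
        have hv' := hagree (v := v) fun h => hne (h.trans hv)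
        exact hown ⟨v, hv', (current_of_unassigned hv').symm.trans hv⟩
      · exact hown ⟨s, hs, (current_of_unassigned hs).symm.trans
          (hsub (show s ∈ {v | Y v = Y s} from rfl))⟩
    obtain ⟨r, hr, -, hex⟩ := hM.exists_exchangeable hY hσ hlt
    have hv : ∃ v, P.current σ v = r ∧ Y v ≠ r := by
      by_contra! hno
      exact absurd hr (not_lt.2 (Set.ncard_le_ncard hno (Set.toFinite _)))
    obtain ⟨v, hvr, hne⟩ := hv
    have hv := hagree (v := v) fun h => hne (h.trans hvr)
    obtain rfl := (current_of_unassigned hv).symm.trans hvr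
    exact ⟨v, hv, hex⟩

/-! ### The invariant of the algorithm -/

/-- The invariant of the algorithm: the current matching is allowed, and every pair that has a
permissible unassigned student is still in the market. -/
structure IsConsistent (P : Problem S D C T) (Ξ : Set (Dist C T)) (σ : TTCState S C T) :
    Prop where
  dist_mem : pairDist (P.current σ) ∈ Ξ ∩ P.basicPolicy
  mem_market : ∀ p, (P.candidates Ξ σ p).Nonempty → p ∈ σ.market

theorem IsConsistent.mem_remainingPairs (hσ : P.IsConsistent Ξ σ) {p : C × T}
    (h : (P.candidates Ξ σ p).Nonempty) : p ∈ P.remainingPairs Ξ σ :=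
  ⟨hσ.mem_market p h, h⟩

theorem IsConsistent.initialPair_mem (hσ : P.IsConsistent Ξ σ) {s : S}
    (hs : σ.assigned s = none) : P.initialPair s ∈ P.remainingPairs Ξ σ :=
  hσ.mem_remainingPairs ⟨s, hs, exchangeable_self hσ.dist_mem _⟩

theorem IsConsistent.pr_ne_initialPair (hσ : P.IsConsistent Ξ σ) {W : Finset S} {pr : S → C × T}
    (hW : ∀ u ∈ W, P.PairPointsTo Ξ master σ (pr u) u ∧ P.initialPair u ≠ pr u) :
    ∀ v ∈ W, ∀ w ∈ W, pr v ≠ P.initialPair w := fun v hv w hw h =>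
  (hW v hv).2 ((hW v hv).1.initialPair_eq hσ.dist_mem (hW w hw).1.unassigned h.symm)

theorem initialPair_injOn {W : Finset S} {pr : S → C × T}
    (hW : ∀ u ∈ W, P.PairPointsTo Ξ master σ (pr u) u ∧ P.initialPair u ≠ pr u) :
    Set.InjOn P.initialPair W := by
  intro v hv w hw h
  by_contra hne
  exact master.asymm ((hW v hv).1.master_rel (hW w hw).1.unassigned h.symm (Ne.symm hne))
    ((hW w hw).1.master_rel (hW v hv).1.unassigned h hne)

theorem not_exchangeable_of_rank_lt {W : Finset S} {pr : S → C × T}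
    (hW : ∀ u ∈ W, P.PairPointsTo Ξ master σ (pr u) u ∧ P.initialPair u ≠ pr u) :
    ∀ v ∈ W, ∀ w ∈ W, master.rank v < master.rank w →
      ¬ Exchangeable (Ξ ∩ P.basicPolicy) (pairDist (P.current σ)) (P.initialPair v) (pr w) :=
  fun v hv w hw h => (hW w hw).1.not_exchangeable (hW w hw).2 (hW v hv).1.unassigned
    (master.rank_lt_rank.1 h)

/-- Students who are pointed to by pairs other than their initial ones can be moved to these pairs
simultaneously: the common master list makes the exchanges triangular. -/
theorem IsConsistent.exists_sum_exchange (hM : MConvex (Ξ ∩ P.basicPolicy))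
    (hσ : P.IsConsistent Ξ σ) {W : Finset S} {pr : S → C × T}
    (hW : ∀ u ∈ W, P.PairPointsTo Ξ master σ (pr u) u ∧ P.initialPair u ≠ pr u) :
    ∃ ζ ∈ Ξ ∩ P.basicPolicy, ζ + ∑ u ∈ W, chi (P.initialPair u)
      = pairDist (P.current σ) + ∑ u ∈ W, chi (pr u) :=
  hM.exists_sum_exchange hσ.dist_mem pr P.initialPair master.rank W (hσ.pr_ne_initialPair hW)
    (initialPair_injOn hW) master.rank_injective.injOn (fun u hu => (hW u hu).1.2.1.2)
    (not_exchangeable_of_rank_lt hW)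

theorem IsConsistent.ttcStep (hM : MConvex (Ξ ∩ P.basicPolicy)) (hσ : P.IsConsistent Ξ σ)
    (master : StrictRanking S) (Q : S → StrictRanking (C × T)) :
    P.IsConsistent Ξ (P.ttcStep Ξ master Q σ) := by
  classical
  obtain ⟨W, pr, hW, hsum⟩ := P.exists_pairDist_ttcStep Ξ master Q σ
  obtain ⟨ζ, hζ, hsumζ⟩ := hσ.exists_sum_exchange hM fun u hu => (hW u hu).2
  obtain rfl : ζ = _ := add_right_cancel (hsumζ.trans hsum.symm)
  refine ⟨hζ, fun p ⟨s, hs, η, hη, hsumη⟩ => ?_⟩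
  -- Moving `s` to `p` turns the matching after the step into a completion with distribution `η`.
  have hs' := current_of_unassigned (P := P) hs
  set Y := Function.update (P.current (P.ttcStep Ξ master Q σ)) s p
  have hYη : pairDist Y = η := by
    have h : pairDist Y + chi (P.initialPair s)
        = pairDist (P.current (P.ttcStep Ξ master Q σ)) + chi p := by
      rw [pairDist_eq_sum, pairDist_eq_sum, ← Finset.add_sum_erase _ _ (Finset.mem_univ s),
        ← Finset.add_sum_erase _ (fun v => chi (P.current _ v)) (Finset.mem_univ s), hs',
        Finset.sum_congr rfl fun v hv => by
          rw [show Y v = _ from Function.update_of_ne (Finset.ne_of_mem_erase hv) _ _]]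
      simp only [Y, Function.update_self]
      abel
    exact add_right_cancel (h.trans hsumη.symm)
  refine hσ.mem_remainingPairs ?_
  have hYs : Y s = p := Function.update_self _ _ _
  rw [← hYs]
  refine candidates_nonempty_of_completion hM hσ.dist_mem (hYη ▸ hη) (fun v x hv => ?_)
    (unassigned_of_ttcStep hs).1
  have hvs : v ≠ s := by
    rintro rfl
    simp [(unassigned_of_ttcStep hs).1] at hv
  exact (Function.update_of_ne hvs _ _).trans
    (current_of_assigned (assigned_ttcStep_of_eq_some hv))

/-- A pair keeps pointing to a student until she is assigned. -/
theorem PairPointsTo.ttcStep (hM : MConvex (Ξ ∩ P.basicPolicy)) (hσ : P.IsConsistent Ξ σ)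
    {p : C × T} {s : S} (h : P.PairPointsTo Ξ master σ p s)
    (hs : (P.ttcStep Ξ master Q σ).assigned s = none) :
    P.PairPointsTo Ξ master (P.ttcStep Ξ master Q σ) p s := by
  classical
  have hσ' := hσ.ttcStep hM master Q
  by_cases hsp : P.initialPair s = p
  · have hcand : s ∈ P.candidates Ξ (P.ttcStep Ξ master Q σ) p :=
      ⟨hs, hsp ▸ exchangeable_self hσ'.dist_mem _⟩
    refine ⟨hσ'.mem_remainingPairs ⟨s, hcand⟩, hcand, fun v hv hne => ?_⟩
    by_cases hvp : P.initialPair v = p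
    · exact .inr ⟨by simp [hsp, hvp],
        h.master_rel (unassigned_of_ttcStep hv.1).1 (hvp.trans hsp.symm) hne⟩
    · exact .inl ⟨hsp, hvp⟩
  have hown : ∀ v, σ.assigned v = none → P.initialPair v ≠ p := fun v hv hvp =>
    hsp (h.initialPair_eq hσ.dist_mem hv hvp)
  obtain ⟨W, pr, hW, hsum⟩ := P.exists_pairDist_ttcStep Ξ master Q σ
  have hout : ∀ v, (P.ttcStep Ξ master Q σ).assigned v = none → v ∉ W := fun v hv hvW =>
    (unassigned_of_ttcStep hv).2 (hW v hvW).1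
  have hW' := fun u hu => (hW u hu).2
  have hcand : s ∈ P.candidates Ξ (P.ttcStep Ξ master Q σ) p := by
    refine ⟨hs, ?_⟩
    -- The exchange of `s` extends the family of executed exchanges.
    have hne : ∀ u ∈ W, Function.update pr s p u = pr u := fun u hu =>
      Function.update_of_ne (by rintro rfl; exact hout u hs hu) _ _
    obtain ⟨ζ, hζ, hsumζ⟩ := hσ.exists_sum_exchange hM (master := master) (W := insert s W)
      (pr := Function.update pr s p) fun u hu => by
        rcases Finset.mem_insert.1 hu with rfl | hu
        · rw [Function.update_self]
          exact ⟨h, hsp⟩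
        · rw [hne u hu]
          exact hW' u hu
    have hpr : ∑ u ∈ W, chi (Function.update pr s p u) = ∑ u ∈ W, chi (pr u) :=
      Finset.sum_congr rfl fun u hu => by rw [hne u hu]
    rw [Finset.sum_insert (hout s hs), Finset.sum_insert (hout s hs), Function.update_self, hpr,
      add_left_comm _ (chi p), ← hsum] at hsumζ
    refine ⟨ζ, hζ, add_right_cancel (b := ∑ u ∈ W, chi (P.initialPair u)) ?_⟩
    rw [add_assoc, hsumζ]
    abel
  refine ⟨hσ'.mem_remainingPairs ⟨s, hcand⟩, hcand, fun v hv hne => ?_⟩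
  obtain ⟨hvσ, hvc⟩ := unassigned_of_ttcStep hv.1
  refine .inr ⟨by simp [hsp, hown v hvσ], (master.connex s v (Ne.symm hne)).resolve_right
    fun hvs => ?_⟩
  refine hM.not_exchangeable_after hσ.dist_mem pr P.initialPair master.rank W
    (hσ.pr_ne_initialPair hW') (initialPair_injOn hW') master.rank_injective.injOn
    (fun u hu => (hW' u hu).1.2.1.2) (not_exchangeable_of_rank_lt hW') hsum
    (a := p) (b := P.initialPair v) (n := master.rank v) (fun u hu hr => ?_)
    (hown v hvσ).symm (fun u hu => (hown u (hW' u hu).1.unassigned).symm) (fun u hu hr => ?_)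
    (h.not_exchangeable hsp hvσ hvs) (fun u hu hr => ?_) (fun u hu hr => ?_) hv.2
  · exact hout v hv.1 (master.rank_injective hr ▸ hu)
  · exact (hW' u hu).2 ((hW' u hu).1.initialPair_eq hσ.dist_mem hvσ hr.symm)
  · exact h.not_exchangeable hsp (hW' u hu).1.unassigned
      (master.trans _ _ _ (master.rank_lt_rank.1 hr) hvs)
  · exact (hW' u hu).1.not_exchangeable (hW' u hu).2 hvσ (master.rank_lt_rank.1 hr)

theorem StudentPointsTo.ttcStep {s : S} {p : C × T} (h : P.StudentPointsTo Ξ Q σ s p)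
    (hs : (P.ttcStep Ξ master Q σ).assigned s = none)
    (hp : p ∈ P.remainingPairs Ξ (P.ttcStep Ξ master Q σ)) :
    P.StudentPointsTo Ξ Q (P.ttcStep Ξ master Q σ) s p :=
  ⟨hs, hp, fun p' hp' => h.2.2 p' hp'.1⟩

theorem IsConsistent.exists_inCycle (hσ : P.IsConsistent Ξ σ) {s : S} (hs : σ.assigned s = none) :
    ∃ a, P.InCycle Ξ master Q σ a := by
  refine exists_transGen_self {a | σ.assigned a = none} ⟨s, hs⟩ fun a ha => ?_
  obtain ⟨p, hp⟩ := exists_studentPointsTo (Q := Q) ha ⟨_, hσ.initialPair_mem ha⟩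
  obtain ⟨b, hb⟩ := exists_pairPointsTo (master := master) hp.2.1
  exact ⟨b, hb.unassigned, p, hp, hb⟩

/-! ### The states of the algorithm -/

theorem ttcState_succ (n : ℕ) : P.ttcState Ξ master Q (n + 1)
    = P.ttcStep Ξ master Q (P.ttcState Ξ master Q n) :=
  Function.iterate_succ_apply' _ _ _

theorem isConsistent_ttcState (hM : MConvex (Ξ ∩ P.basicPolicy))
    (h₀ : pairDist P.initialPair ∈ Ξ ∩ P.basicPolicy) (n : ℕ) :
    P.IsConsistent Ξ (P.ttcState Ξ master Q n) := by
  induction n with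
  | zero => exact ⟨h₀, fun _ _ => Set.mem_univ _⟩
  | succ n ih => exact ttcState_succ (P := P) n ▸ ih.ttcStep hM _ _

theorem ttcState_assigned_mono {s : S} {p : C × T} {m n : ℕ} (hmn : m ≤ n)
    (h : (P.ttcState Ξ master Q m).assigned s = some p) :
    (P.ttcState Ξ master Q n).assigned s = some p := by
  induction n, hmn using Nat.le_induction with
  | base => exact h
  | succ n _ ih => exact ttcState_succ (P := P) n ▸ assigned_ttcStep_of_eq_some ih

theorem ttcState_unassigned_anti {s : S} {m n : ℕ} (hmn : m ≤ n)
    (h : (P.ttcState Ξ master Q n).assigned s = none) :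
    (P.ttcState Ξ master Q m).assigned s = none := by
  by_contra hne
  obtain ⟨p, hp⟩ := Option.ne_none_iff_exists'.1 hne
  simp [ttcState_assigned_mono hmn hp] at h

theorem remainingPairs_ttcState_anti {m n : ℕ} (hmn : m ≤ n) :
    P.remainingPairs Ξ (P.ttcState Ξ master Q n)
      ⊆ P.remainingPairs Ξ (P.ttcState Ξ master Q m) := by
  induction n, hmn using Nat.le_induction with
  | base => exact subset_rfl
  | succ n _ ih =>
    rw [ttcState_succ]
    exact fun p hp => ih hp.1

theorem exists_pointing_of_assigned {s : S} {p : C × T} {n : ℕ}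
    (h : (P.ttcState Ξ master Q n).assigned s = some p) :
    ∃ m, P.InCycle Ξ master Q (P.ttcState Ξ master Q m) s ∧
      P.StudentPointsTo Ξ Q (P.ttcState Ξ master Q m) s p := by
  induction n with
  | zero => simp [ttcState] at h
  | succ n ih =>
    rw [ttcState_succ] at h
    rcases assigned_ttcStep_eq_some h with h | h
    · exact ih h
    · exact ⟨n, h⟩

theorem exists_doneAfter (hM : MConvex (Ξ ∩ P.basicPolicy))
    (h₀ : pairDist P.initialPair ∈ Ξ ∩ P.basicPolicy) : ∃ n, P.DoneAfter Ξ master Q n := by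
  have key : ∀ n, {s | (P.ttcState Ξ master Q n).assigned s = none}.ncard
      ≤ Fintype.card S - n := by
    intro n
    induction n with
    | zero => exact (Set.ncard_le_card _).trans (by simp)
    | succ n ih =>
      set U := {s | (P.ttcState Ξ master Q (n + 1)).assigned s = none} with hU
      rcases U.eq_empty_or_nonempty with h | ⟨s, hs⟩
      · simp [h]
      have hs' := ttcState_unassigned_anti n.le_succ hs
      obtain ⟨a, ha⟩ := (isConsistent_ttcState hM h₀ n).exists_inCycle (master := master)
        (Q := Q) hs'
      have hlt : U.ncard < {s | (P.ttcState Ξ master Q n).assigned s = none}.ncard := by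
        refine Set.ncard_lt_ncard ⟨fun v hv => ttcState_unassigned_anti n.le_succ hv,
          fun hsub => ?_⟩ (Set.toFinite _)
        have hb : a ∈ U := hsub ha.unassigned
        rw [hU, Set.mem_ofPred_eq, ttcState_succ] at hb
        exact (unassigned_of_ttcStep hb).2 ha
      omega
  refine ⟨Fintype.card S, fun s hs => ?_⟩
  have h := key (Fintype.card S)
  rw [Nat.sub_self, Nat.le_zero, Set.ncard_eq_zero (Set.toFinite _)] at h
  exact (Set.mem_empty_iff_false s).1 (h ▸ hs)

theorem weak_initialPair_of_assigned (hM : MConvex (Ξ ∩ P.basicPolicy))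
    (h₀ : pairDist P.initialPair ∈ Ξ ∩ P.basicPolicy) {s : S} {p : C × T} {n : ℕ}
    (h : (P.ttcState Ξ master Q n).assigned s = some p) : (Q s).weak p (P.initialPair s) := by
  obtain ⟨m, hc, hp⟩ := exists_pointing_of_assigned h
  exact hp.weak ((isConsistent_ttcState hM h₀ m).initialPair_mem hc.unassigned)

/-! ### Misreports -/

/-- Two reports of `s` lead to the same step if `s` is on no cycle under either of them. -/
theorem ttcStep_congr {s : S} (hQ : ∀ t, t ≠ s → Q t = Q' t)
    (h : ¬ P.InCycle Ξ master Q σ s) (h' : ¬ P.InCycle Ξ master Q' σ s) :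
    P.ttcStep Ξ master Q σ = P.ttcStep Ξ master Q' σ := by
  have hpt : ∀ t p, t ≠ s → (P.StudentPointsTo Ξ Q σ t p ↔ P.StudentPointsTo Ξ Q' σ t p) := by
    intro t p ht
    unfold StudentPointsTo
    rw [hQ t ht]
  have hcyc : ∀ t, P.InCycle Ξ master Q σ t ↔ P.InCycle Ξ master Q' σ t := fun t =>
    ⟨transGen_congr_off (fun a b ha ⟨p, hp, hpb⟩ => ⟨p, (hpt a p ha).1 hp, hpb⟩) h,
      transGen_congr_off (fun a b ha ⟨p, hp, hpb⟩ => ⟨p, (hpt a p ha).2 hp, hpb⟩) h'⟩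
  have hassigned : (P.ttcStep Ξ master Q σ).assigned = (P.ttcStep Ξ master Q' σ).assigned := by
    funext t
    by_cases ht : P.InCycle Ξ master Q σ t
    · have hts : t ≠ s := by rintro rfl; exact h ht
      obtain ⟨p, hp⟩ := ht.exists_studentPointsTo
      rw [ht.assigned_ttcStep hp, ((hcyc t).1 ht).assigned_ttcStep ((hpt t p hts).1 hp)]
    · rw [assigned_ttcStep_of_not_inCycle ht,
        assigned_ttcStep_of_not_inCycle (mt (hcyc t).2 ht)]
  exact congrArg (TTCState.mk · (P.remainingPairs Ξ σ)) hassigned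

theorem ttcState_congr {s : S} (hQ : ∀ t, t ≠ s → Q t = Q' t) {n : ℕ}
    (h : (P.ttcState Ξ master Q n).assigned s = none)
    (h' : (P.ttcState Ξ master Q' n).assigned s = none) :
    P.ttcState Ξ master Q n = P.ttcState Ξ master Q' n := by
  induction n with
  | zero => rfl
  | succ n ih =>
    have heq := ih (ttcState_unassigned_anti n.le_succ h) (ttcState_unassigned_anti n.le_succ h')
    rw [ttcState_succ] at h h' ⊢
    rw [ttcState_succ, ← heq]
    rw [← heq] at h'
    exact ttcStep_congr hQ (unassigned_of_ttcStep h).2 (unassigned_of_ttcStep h').2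

/-- A pair from which the pointers lead to `s` remains such a pair until `s` is assigned. -/
theorem reflTransGen_follows_ttcStep (hM : MConvex (Ξ ∩ P.basicPolicy)) (hσ : P.IsConsistent Ξ σ)
    {p : C × T} {a s : S} (hp : P.PairPointsTo Ξ master σ p a)
    (ha : Relation.ReflTransGen (P.Follows Ξ master Q σ) a s)
    (hs : (P.ttcStep Ξ master Q σ).assigned s = none) :
    P.PairPointsTo Ξ master (P.ttcStep Ξ master Q σ) p a ∧
      Relation.ReflTransGen (P.Follows Ξ master Q (P.ttcStep Ξ master Q σ)) a s := by
  have hun : ∀ b, Relation.ReflTransGen (P.Follows Ξ master Q σ) b s →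
      (P.ttcStep Ξ master Q σ).assigned b = none := by
    intro b hb
    have hc : ¬ P.InCycle Ξ master Q σ b := fun hc => (unassigned_of_ttcStep hs).2
      (transGen_self_of_reflTransGen (r := P.Follows Ξ master Q σ) (fun _ _ _ h₁ h₂ => h₁.unique h₂) hb hc)
    rcases Relation.ReflTransGen.cases_head hb with rfl | ⟨c, ⟨_, hbx, -⟩, -⟩
    · exact hs
    · rw [assigned_ttcStep_of_not_inCycle hc, hbx.1]
  refine ⟨hp.ttcStep hM hσ (hun a ha), ?_⟩
  clear hp
  induction ha using Relation.ReflTransGen.head_induction_on with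
  | refl => exact .refl
  | @head b c hbc hcs ih =>
    obtain ⟨x, hbx, hxc⟩ := hbc
    have hxc' := hxc.ttcStep (Q := Q) hM hσ (hun c hcs)
    exact .head ⟨x, hbx.ttcStep (hun b (.head ⟨x, hbx, hxc⟩ hcs)) hxc'.1, hxc'⟩ ih

/-- The hypothetical market is strategy-proof: `x`, which `s` gets from the report `Q s`, is weakly
better under `Q s` than `y`, which she gets from the report `Q' s`. -/
theorem weak_of_misreport (hM : MConvex (Ξ ∩ P.basicPolicy))
    (h₀ : pairDist P.initialPair ∈ Ξ ∩ P.basicPolicy) {s : S} (hQ : ∀ t, t ≠ s → Q t = Q' t)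
    {n n' : ℕ} {x y : C × T} (hx : (P.ttcState Ξ master Q n).assigned s = some x)
    (hy : (P.ttcState Ξ master Q' n').assigned s = some y) : (Q s).weak x y := by
  obtain ⟨m, hmc, hmx⟩ := exists_pointing_of_assigned hx
  obtain ⟨m', hmc', hmy⟩ := exists_pointing_of_assigned hy
  refine hmx.weak ?_
  rcases le_or_gt m m' with hle | hlt
  · rw [ttcState_congr hQ hmx.1 (ttcState_unassigned_anti hle hmy.1)]
    exact remainingPairs_ttcState_anti hle hmy.2.1
  -- The cycle that `s` closes by pointing to `y` is a chain from `y` to `s` under the report `Q s`.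
  have heq := ttcState_congr hQ (ttcState_unassigned_anti hlt.le hmx.1) hmy.1
  rw [← heq] at hmc' hmy
  obtain ⟨a, ⟨z, hz, hya⟩, has⟩ := Relation.TransGen.head'_iff.1 hmc'
  obtain rfl := hmy.unique hz
  have has' : Relation.ReflTransGen (P.Follows Ξ master Q (P.ttcState Ξ master Q m')) a s := by
    refine reflTransGen_congr_off (fun b c hb ⟨z, hz, hzc⟩ => ⟨z, ?_, hzc⟩) has
    unfold StudentPointsTo at hz ⊢
    rwa [hQ b hb]
  have key : ∀ k, m' ≤ k → (P.ttcState Ξ master Q k).assigned s = none →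
      P.PairPointsTo Ξ master (P.ttcState Ξ master Q k) y a ∧
        Relation.ReflTransGen (P.Follows Ξ master Q (P.ttcState Ξ master Q k)) a s := by
    intro k hk
    induction k, hk using Nat.le_induction with
    | base => exact fun _ => ⟨hya, has'⟩
    | succ k _ ih =>
      intro hs
      obtain ⟨h₁, h₂⟩ := ih (ttcState_unassigned_anti k.le_succ hs)
      rw [ttcState_succ] at hs ⊢
      exact reflTransGen_follows_ttcStep hM (isConsistent_ttcState hM h₀ k) h₁ h₂ hs
  exact (key m hlt.le hmx.1).1.1

/-! ### The outcome of the algorithm -/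

theorem sum_ncard_fiber {A : Type*} [Fintype A] (f : S → A) (p : S → Prop) :
    ∑ a, {s | p s ∧ f s = a}.ncard = {s | p s}.ncard := by
  classical
  simp only [Set.ncard_eq_toFinset_card', Set.toFinset_ofPred]
  rw [Finset.card_eq_sum_card_fiberwise (f := f) (t := Finset.univ) (by simp)]
  simp [Finset.filter_filter]

/-- The distribution of a matching of all students satisfies the basic policy exactly if no school
exceeds its capacity. -/
theorem pairDist_mem_basicPolicy {Y : S → C × T} :
    pairDist Y ∈ P.basicPolicy ↔ ∀ c, {s | (Y s).1 = c}.ncard ≤ P.capacity c := by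
  have h₁ : ∑ p, pairDist Y p = ∑ d, P.districtSize d := by
    have h := sum_ncard_fiber Y fun _ => True
    have h' := sum_ncard_fiber P.studentDistrict fun _ => True
    simp only [true_and] at h h'
    exact h.trans h'.symm
  have h₂ : ∀ c, ∑ t, pairDist Y (c, t) = {s | (Y s).1 = c}.ncard := fun c => by
    rw [← sum_ncard_fiber (fun s => (Y s).2)]
    simp [pairDist, Prod.ext_iff]
  simp [basicPolicy, h₁, h₂]

theorem pairDist_initialPair_mem (h : P.SatisfiesPolicy Ξ P.initialMatching) :
    pairDist P.initialPair ∈ Ξ ∩ P.basicPolicy := by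
  refine ⟨?_, pairDist_mem_basicPolicy.2 P.initial_feasible⟩
  rw [← dist_eq_pairDist (X := P.initialMatching) fun s => ⟨rfl, rfl⟩]
  exact h

/-- The assignment of pairs at the end of the algorithm. -/
theorem exists_outcome (hM : MConvex (Ξ ∩ P.basicPolicy))
    (h₀ : pairDist P.initialPair ∈ Ξ ∩ P.basicPolicy)
    (hyp : S → SchoolPref C → StrictRanking (C × T)) (R : Profile S C) :
    ∃ (Y : S → C × T) (n : ℕ),
      (∀ s, (P.ttcState Ξ master (fun i => hyp i (R i)) n).assigned s = some (Y s)) ∧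
      ∀ s, P.ttc Ξ master hyp R s = some (Y s).1 := by
  have hdone := Nat.sInf_mem (exists_doneAfter (P := P) (master := master)
    (Q := fun i => hyp i (R i)) hM h₀)
  choose Y hY using fun s => Option.ne_none_iff_exists'.1 (hdone s)
  exact ⟨Y, _, hY, fun s => congrArg (Option.map Prod.fst) (hY s)⟩

end Problem

end SchoolChoice

/-! ### The properties of the mechanism -/

open SchoolChoice Problem in
theorem theorem5 {S D C T : Type*} [Fintype S] [Fintype D] [Fintype C] [Fintype T]
    (P : SchoolChoice.Problem S D C T) (Ξ : Set (SchoolChoice.Dist C T))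
    (master : SchoolChoice.StrictRanking S)
    (hyp : S → SchoolChoice.SchoolPref C → SchoolChoice.StrictRanking (C × T))
    (hhyp : ∀ s R, P.IsHypotheticalPref s R (hyp s R))
    (hinit : P.SatisfiesPolicy Ξ P.initialMatching)
    (hM : SchoolChoice.MConvex (Ξ ∩ P.basicPolicy)) :
    (∀ R : SchoolChoice.Profile S C,
      (∃ n, P.DoneAfter Ξ master (fun s => hyp s (R s)) n) ∧
      P.Feasible (P.ttc Ξ master hyp R) ∧
      P.SatisfiesPolicy Ξ (P.ttc Ξ master hyp R) ∧
      P.ConstrainedEfficient Ξ R (P.ttc Ξ master hyp R) ∧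
      P.IndividuallyRational R (P.ttc Ξ master hyp R)) ∧
    SchoolChoice.StrategyProof (P.ttc Ξ master hyp) := by
  classical
  have h₀ := pairDist_initialPair_mem hinit
  refine ⟨fun R => ?_, fun R s ⟨R', hR'⟩ => ?_⟩
  · obtain ⟨X, N, hX, httc⟩ := exists_outcome (master := master) hM h₀ hyp R
    have hweak := fun s => weak_initialPair_of_assigned hM h₀ (hX s)
    have htype := fun s => (hhyp s (R s)).snd_eq (hweak s)
    have hmem : pairDist X ∈ Ξ ∩ P.basicPolicy := by
      have h := (isConsistent_ttcState (master := master) (Q := fun i => hyp i (R i))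
        hM h₀ N).dist_mem
      rwa [show P.current _ = X from funext fun s => current_of_assigned (hX s)] at h
    have hfeas : P.Feasible (P.ttc Ξ master hyp R) := fun c => by
      simpa [httc] using pairDist_mem_basicPolicy.1 hmem.2 c
    have hpol : P.SatisfiesPolicy Ξ (P.ttc Ξ master hyp R) := by
      rw [SatisfiesPolicy, dist_eq_pairDist fun s => ⟨httc s, htype s⟩]
      exact hmem.1
    refine ⟨exists_doneAfter hM h₀, hfeas, hpol, ⟨hfeas, hpol, ?_⟩, fun s => ?_⟩
    · rintro ⟨Y, hYfeas, hYpol, hYweak, t, ht⟩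
      have hsome : ∀ s, ∃ c, Y s = some c := fun s => by
        refine Option.ne_none_iff_exists'.1 fun hs => ?_
        have h := hYweak s
        rw [hs, httc] at h
        rcases h with h | h
        · exact (R s).asymm h ((R s).outside_last _)
        · simp at h
      choose y hy using hsome
      set Z : S → C × T := fun s => (y s, P.typeOf s)
      have hZ : pairDist Z ∈ Ξ ∩ P.basicPolicy := by
        refine ⟨?_, pairDist_mem_basicPolicy.2 fun c => by simpa [hy] using hYfeas c⟩
        rw [← dist_eq_pairDist (P := P) (X := Y) fun s => ⟨hy s, rfl⟩]
        exact hYpol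
      -- By induction on the steps, every student who is assigned gets her pair in `Z`: she gets
      -- the best remaining pair, and her pair in `Z` is remaining.
      have key : ∀ n s p, (P.ttcState Ξ master (fun i => hyp i (R i)) n).assigned s = some p →
          Z s = p := by
        intro n
        induction n with
        | zero => intro s p h; simp [ttcState] at h
        | succ n ih =>
          intro s p h
          have hpX : p = X s := by
            have h₁ := ttcState_assigned_mono (le_max_left (n + 1) N) h
            have h₂ := ttcState_assigned_mono (le_max_right (n + 1) N) (hX s)
            exact Option.some_inj.1 (h₁.symm.trans h₂)
          rw [ttcState_succ] at h
          rcases assigned_ttcStep_eq_some h with h | ⟨-, h⟩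
          · exact ih s p h
          have hcons := isConsistent_ttcState (master := master) (Q := fun i => hyp i (R i))
            hM h₀ n
          have hrem := hcons.mem_remainingPairs
            (candidates_nonempty_of_completion hM hcons.dist_mem hZ ih h.1)
          have hw : (hyp s (R s)).weak (Z s) p := by
            rw [hpX, (hhyp s (R s)).weak_iff rfl (htype s), ← httc, ← hy]
            exact hYweak s
          rcases hw with hw | hw
          · rcases h.weak hrem with h' | h'
            · exact absurd h' ((hyp s (R s)).asymm hw)
            · exact h'.symm
          · exact hw
      rw [httc, hy, ← key N t _ (hX t)] at ht
      exact (R t).irrefl _ ht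
    · rw [httc]
      exact ((hhyp s (R s)).weak_iff (htype s) rfl).1 (hweak s)
  · obtain ⟨X, n, hX, httc⟩ := exists_outcome (master := master) hM h₀ hyp R
    obtain ⟨X', n', hX', httc'⟩ :=
      exists_outcome (master := master) hM h₀ hyp (Function.update R s R')
    have htype := (hhyp s (R s)).snd_eq (weak_initialPair_of_assigned hM h₀ (hX s))
    have htype' := (hhyp s _).snd_eq (weak_initialPair_of_assigned hM h₀ (hX' s))
    have hw := weak_of_misreport hM h₀ (s := s)
      (fun t ht => by simp [Function.update_of_ne ht]) (hX s) (hX' s)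
    rw [(hhyp s (R s)).weak_iff htype htype', ← httc, ← httc'] at hw
    rcases hw with hw | hw
    · exact (R s).asymm hw hR'
    · rw [hw] at hR'
      exact (R s).irrefl _ hR'
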